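/- **Setting.** Consider a connected weighted graph with $n\ge 1$ load buses and $m\ge 1$ inverter buses, whose branches $\{i,j\}$ are lossless inductive lines with admittance $\mathbf{j}\,b_{ij}$, $b_{ij}=b_{ji}<0$ (and $b_{ij}=0$ if $\{i,j\}$ is not a branch). The susceptance matrix $B\in\mathbb{R}^{(n+m)\times(n+m)}$ has the entries $B_{ij}=-b_{ij}$ for $i\ne j$ and $B_{ii}=\sum_{j\neq i}b_{ij}$; partition $B=\begin{pmatrix}B_{LL}&B_{LI}\\B_{IL}&B_{II}\end{pmatrix}$ and $E=(E_L,E_I)$ according to loads and inverters. Let $\tau_I,K_I$ be diagonal $m\times m$ matrices with diagonal entries $\tau_i>0$ and $K_i<0$, and let $E_I^*\in\mathbb{R}^m_{>0}$. For a vector $x$, $[x]$ denotes the diagonal matrix with diagonal $x$. Given a static load model $Q_L(E_L)$, the closed-loop system under quadratic droop control is the differential-algebraic system $$\begin{pmatrix}0\\ \tau_I\dot E_I\end{pmatrix}=\begin{pmatrix}Q_L(E_L)\\ [E_I]K_I(E_I-E_I^*)\end{pmatrix}+[E]BE .$$ Define $B_{\rm red}=B_{LL}-B_{LI}(B_{II}+K_I)^{-1}B_{IL}$,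 $E_L^*=-B_{\rm red}^{-1}B_{LI}(B_{II}+K_I)^{-1}K_IE_I^*$, and the reduced power flow equation $$0=Q_L(E_L)+[E_L]B_{\rm red}(E_L-E_L^*).$$ A matrix is an $M$-matrix if its off-diagonal entries are nonpositive and all its eigenvalues have positive real part. **Theorem (Stability with "ZI" loads).** Consider constant-impedance/constant-current loads $$Q_L^{\rm ZI}(E_L)=[E_L][b_{\rm shunt}]E_L+[E_L]I_{\rm shunt},\qquad b_{\rm shunt},I_{\rm shunt}\in\mathbb{R}^n,$$ and assume that (i) $-(B_{\rm red}+[b_{\rm shunt}])$ is an $M$-matrix, and (ii) $I_{\rm shunt}>B_{\rm red}E_L^*$ component-wise. Then $B_{\rm red}+[b_{\rm shunt}]$ is nonsingular, and the reduced power flow equation with $Q_L=Q_L^{\rm ZI}$ has exactly one solution in $\mathbb{R}^n_{>0}$, namely $$E_L^{\rm ZI}=(B_{\rm red}+[b_{\rm shunt}])^{-1}(B_{\rm red}E_L^*-I_{\rm shunt}).$$ Moreover, with $E_I^{\rm ZI}=(B_{II}+K_I)^{-1}(K_IE_I^*-B_{IL}E_L^{\rm ZI})$, the associated point $E^{\rm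 ZI}=(E_L^{\rm ZI},E_I^{\rm ZI})$ lies in $\mathbb{R}^{n+m}_{>0}$ and is a locally exponentially stable equilibrium point of the closed-loop system: there are $r,C,c>0$ such that from each $x\in\mathbb{R}^{n+m}$ that satisfies the algebraic (load) equations and $\|x-E^{\rm ZI}\|<r$ there starts a solution on $[0,\infty)$, and every solution $E$ on an interval $[0,T)$ with $E(0)=x$ satisfies $\|E(t)-E^{\rm ZI}\|\le Ce^{-ct}\|x-E^{\rm ZI}\|$ for $0\le t<T$. (A solution is a continuous function of time with differentiable $E_I$ for which the differential-algebraic system holds at all times.) -/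

import Mathlib

open Matrix Set

noncomputable section

/-- A real square matrix is an *M-matrix* if its off-diagonal entries are nonpositive and all of
its (complex) eigenvalues have positive real part. -/
def IsMMatrix {ι : Type*} [Fintype ι] [DecidableEq ι] (A : Matrix ι ι ℝ) : Prop :=
  (∀ i j, i ≠ j → A i j ≤ 0) ∧
    ∀ μ : ℂ, Module.End.HasEigenvalue (Matrix.toLin' (A.map ((↑) : ℝ → ℂ))) μ → 0 < μ.re

/-- A lossless inductive microgrid with load buses `L` and inverter buses `I`, in which every
inverter runs the quadratic droop controller.

The network is a connected graph on `L ⊕ I`; the branch `{i, j}` has the purely imaginary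
admittance `𝐣 b i j` with `b i j < 0` (an inductive line).  The inverter `i` has the time constant
`τ i > 0`, the controller gain `K i < 0` and the nominal voltage `Estar i > 0`. -/
structure Microgrid (L I : Type*) where
  graph : SimpleGraph (L ⊕ I)
  connected : graph.Connected
  b : L ⊕ I → L ⊕ I → ℝ
  b_symm : ∀ i j, b i j = b j i
  b_neg : ∀ i j, graph.Adj i j → b i j < 0
  b_zero : ∀ i j, ¬ graph.Adj i j → b i j = 0
  τ : I → ℝ
  τ_pos : ∀ i, 0 < τ i
  K : I → ℝ
  K_neg : ∀ i, K i < 0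
  Estar : I → ℝ
  Estar_pos : ∀ i, 0 < Estar i

namespace Microgrid

variable {L I : Type*} [Fintype L] [DecidableEq L] [Fintype I] [DecidableEq I]

/-- The susceptance matrix `B`, i.e. the bus admittance matrix is `Y = 𝐣 B`: off the diagonal
`Y i j = - y i j`, and on the diagonal `Y i i = ∑_{j ≠ i} y i j`, where `y i j = 𝐣 b i j`. -/
def B (M : Microgrid L I) : Matrix (L ⊕ I) (L ⊕ I) ℝ :=
  Matrix.of fun i j => if i = j then ∑ k ∈ Finset.univ.erase i, M.b i k else - M.b i j

/-- Load-load block of the susceptance matrix. -/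
def BLL (M : Microgrid L I) : Matrix L L ℝ := M.B.toBlocks₁₁

/-- Load-inverter block of the susceptance matrix. -/
def BLI (M : Microgrid L I) : Matrix L I ℝ := M.B.toBlocks₁₂

/-- Inverter-load block of the susceptance matrix. -/
def BIL (M : Microgrid L I) : Matrix I L ℝ := M.B.toBlocks₂₁

/-- Inverter-inverter block of the susceptance matrix. -/
def BII (M : Microgrid L I) : Matrix I I ℝ := M.B.toBlocks₂₂

/-- The diagonal matrix of controller gains. -/
def KI (M : Microgrid L I) : Matrix I I ℝ := Matrix.diagonal M.K

/-- The reduced susceptance matrix `B_LL - B_LI (B_II + K_I)⁻¹ B_IL`. -/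
def Bred (M : Microgrid L I) : Matrix L L ℝ :=
  M.BLL - M.BLI * (M.BII + M.KI)⁻¹ * M.BIL

/-- The averaging matrix `W₁ = - B_red⁻¹ B_LI (B_II + K_I)⁻¹ K_I`. -/
def W₁ (M : Microgrid L I) : Matrix L I ℝ :=
  - (M.Bred⁻¹ * M.BLI * (M.BII + M.KI)⁻¹ * M.KI)

/-- The averaging matrix `W₂ = (B_II + K_I)⁻¹ (-B_IL  K_I)`. -/
def W₂ (M : Microgrid L I) : Matrix I (L ⊕ I) ℝ :=
  (M.BII + M.KI)⁻¹ * Matrix.fromCols (-M.BIL) M.KI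

/-- The open-circuit load voltages `E_L^* = W₁ E_I^*`. -/
def openCircuit (M : Microgrid L I) : L → ℝ := M.W₁ *ᵥ M.Estar

/-- The right-hand side of the closed-loop system with the static load model `QL`: the vector
`(Q_L(E_L), [E_I] K_I (E_I - E_I^*)) + [E] B E`. -/
def closedLoopRHS (M : Microgrid L I) (QL : (L → ℝ) → (L → ℝ)) (E : L ⊕ I → ℝ) : L ⊕ I → ℝ :=
  Sum.elim (QL (E ∘ Sum.inl)) (fun i => E (Sum.inr i) * (M.K i * (E (Sum.inr i) - M.Estar i))) +
    Matrix.diagonal E *ᵥ (M.B *ᵥ E)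

/-- Equilibrium points of the closed-loop differential-algebraic system. -/
def IsEquilibrium (M : Microgrid L I) (QL : (L → ℝ) → (L → ℝ)) (E : L ⊕ I → ℝ) : Prop :=
  M.closedLoopRHS QL E = 0

/-- `E` satisfies the algebraic equations (the power balance at the load buses) of the closed-loop
system, i.e. `E` is a consistent initial value. -/
def IsConsistent (M : Microgrid L I) (QL : (L → ℝ) → (L → ℝ)) (E : L ⊕ I → ℝ) : Prop :=
  ∀ i : L, M.closedLoopRHS QL E (Sum.inl i) = 0

/-- `E` is a solution on the time interval `J` of the closed-loop differential-algebraic system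
`(0, τ_I dE_I/dt) = closedLoopRHS E`: it is continuous, its inverter components are
differentiable (one-sidedly at an end point of `J`), and the equations hold at all times of `J`. -/
def IsSolutionOn (M : Microgrid L I) (QL : (L → ℝ) → (L → ℝ)) (J : Set ℝ)
    (E : ℝ → L ⊕ I → ℝ) : Prop :=
  ContinuousOn E J ∧ ∀ t ∈ J, M.IsConsistent QL (E t) ∧
    ∀ i : I, ∃ v : ℝ, HasDerivWithinAt (fun s => E s (Sum.inr i)) v J t ∧
      M.τ i * v = M.closedLoopRHS QL (E t) (Sum.inr i)

/-- The point `E₀` is a locally exponentially stable equilibrium of the closed-loop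
differential-algebraic system: it is an equilibrium, and there are `r, C, c > 0` such that from
every consistent initial value `x` at distance less than `r` from `E₀` there starts a solution on
`[0, ∞)`, and every solution starting at `x`, on whatever interval `[0, T)`, satisfies
`‖E t - E₀‖ ≤ C exp (-c t) ‖x - E₀‖` as long as it exists. -/
def IsLocallyExponentiallyStable (M : Microgrid L I) (QL : (L → ℝ) → (L → ℝ))
    (E₀ : L ⊕ I → ℝ) : Prop :=
  M.IsEquilibrium QL E₀ ∧
    ∃ r > (0 : ℝ), ∃ C > (0 : ℝ), ∃ c > (0 : ℝ),
      ∀ x : L ⊕ I → ℝ, M.IsConsistent QL x → ‖x - E₀‖ < r →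
        (∃ E : ℝ → L ⊕ I → ℝ, E 0 = x ∧ M.IsSolutionOn QL (Ici 0) E) ∧
        ∀ T > (0 : ℝ), ∀ E : ℝ → L ⊕ I → ℝ, E 0 = x → M.IsSolutionOn QL (Ico 0 T) E →
          ∀ t ∈ Ico 0 T, ‖E t - E₀‖ ≤ C * Real.exp (-c * t) * ‖x - E₀‖

/-- The reduced power flow equation `0 = Q_L(E_L) + [E_L] B_red (E_L - E_L^*)`. -/
def ReducedPowerFlow (M : Microgrid L I) (QL : (L → ℝ) → (L → ℝ)) (EL : L → ℝ) : Prop :=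
  0 = QL EL + Matrix.diagonal EL *ᵥ (M.Bred *ᵥ (EL - M.openCircuit))

/-- The inverter voltages `E_I = W₂ (E_L, E_I^*)` recovered from the load voltages. -/
def inverterVoltages (M : Microgrid L I) (EL : L → ℝ) : I → ℝ :=
  M.W₂ *ᵥ Sum.elim EL M.Estar

end Microgrid

/-- Constant-impedance/constant-current ("ZI") loads:
`Q_L(E_L) = [E_L] [b_shunt] E_L + [E_L] I_shunt`. -/
def ziLoad {L : Type*} [Fintype L] [DecidableEq L] (bshunt Ishunt : L → ℝ) (EL : L → ℝ) : L → ℝ :=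
  Matrix.diagonal EL *ᵥ (Matrix.diagonal bshunt *ᵥ EL) + Matrix.diagonal EL *ᵥ Ishunt

/-- The load voltages `(B_red + [b_shunt])⁻¹ (B_red E_L^* - I_shunt)`. -/
def Microgrid.ziVoltage {L I : Type*} [Fintype L] [DecidableEq L] [Fintype I] [DecidableEq I]
    (M : Microgrid L I) (bshunt Ishunt : L → ℝ) : L → ℝ :=
  (M.Bred + Matrix.diagonal bshunt)⁻¹ *ᵥ (M.Bred *ᵥ M.openCircuit - Ishunt)

end

open Matrix Set

open scoped NNReal

noncomputable section

/-! With ZI loads every bus equation is the voltage `E i` times an affine expression. On the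
positive orthant the reduced power flow is therefore a linear system, which gives uniqueness.
Existence and positivity hold because a symmetric M-matrix is positive definite
(`IsMMatrix.posDef`), and a positive definite matrix with nonpositive off-diagonal entries maps only
positive vectors to positive vectors (`Matrix.PosDef.pos_of_mulVec_pos`).

For stability no linearization is needed. Let `u`, `y` be the deviations of the load and inverter
voltages. While voltages are positive, the algebraic equations say `u = G y`, and the dynamics
become `τ y' = -[E_I] P y`, where `-P` is the Schur complement on the inverters of the network
matrix with shunts and gains. That matrix is negative definite: its inverter block is, since the
network is connected and the gains are negative (`negDef_gain`), and its Schur complement on the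
loads is, by hypothesis (`negDef_shunt`). Hence `P` is positive definite, and `V = yᵀ P y` has
derivative `-2 ∑ (E_i / τ_i) (P y)_i²`, at most `-c V` near the equilibrium
(`Matrix.PosDef.exists_lyapunov`). A trapping argument (`exp_decay_of_lyapunov`) keeps solutions in
that neighbourhood and yields the exponential bound. -/

/-! ### Global integral curves and Lyapunov estimates -/

/-- A bounded Lipschitz vector field on a Banach space has global integral curves. -/
theorem exists_integralCurve_of_bounded_lipschitz {E : Type*} [NormedAddCommGroup E]
    [NormedSpace ℝ E] [CompleteSpace E] {f : E → E} {K N : ℝ≥0} (hf : LipschitzWith K f)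
    (hN : ∀ x, ‖f x‖ ≤ N) (x₀ : E) :
    ∃ γ : ℝ → E, γ 0 = x₀ ∧ ∀ t, HasDerivAt γ (f (γ t)) t := by
  have hloc : ∀ n : ℕ, ∃ α : ℝ → E, α 0 = x₀ ∧
      ∀ t ∈ Icc (-((n : ℝ) + 1)) (n + 1), HasDerivWithinAt α (f (α t))
        (Icc (-((n : ℝ) + 1)) (n + 1)) t := by
    intro n
    have h0 : (0 : ℝ) ∈ Icc (-((n : ℝ) + 1)) (n + 1) := ⟨by linarith [n.cast_nonneg (α := ℝ)],
      by positivity⟩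
    -- At speed at most `N` a curve travels at most `N * (n + 1)` in this time, so a ball of that
    -- radius suffices. The `+ 1` keeps 0 interior to the interval when `n = 0`.
    have hPL : IsPicardLindelof (fun _ => f) (⟨0, h0⟩ : Icc (-((n : ℝ) + 1)) (n + 1)) x₀
        (N * (n + 1)) 0 N K :=
      { lipschitzOnWith := fun _ _ => hf.lipschitzOnWith
        continuousOn := fun _ _ => continuousOn_const
        norm_le := fun _ _ x _ => hN x
        mul_max_le := by simp }
    exact hPL.exists_eq_forall_mem_Icc_hasDerivWithinAt₀
  choose α hα0 hα using hloc
  have hderiv : ∀ n : ℕ, ∀ t ∈ Ioo (-((n : ℝ) + 1)) (n + 1), HasDerivAt (α n) (f (α n t)) t :=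
    fun n t ht => (hα n t (Ioo_subset_Icc_self ht)).hasDerivAt (Icc_mem_nhds ht.1 ht.2)
  have hagree : ∀ n m : ℕ, n ≤ m → ∀ t ∈ Ioo (-((n : ℝ) + 1)) (n + 1), α n t = α m t := by
    intro n m hnm
    have hnm' : (n : ℝ) ≤ m := by exact_mod_cast hnm
    have hn : (0 : ℝ) ≤ n := n.cast_nonneg
    have hsub : Ioo (-((n : ℝ) + 1)) (n + 1) ⊆ Ioo (-((m : ℝ) + 1)) (m + 1) :=
      Ioo_subset_Ioo (by linarith) (by linarith)
    exact ODE_solution_unique_of_mem_Ioo (v := fun _ => f) (s := fun _ => univ)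
      (t₀ := 0) (K := K) (fun _ _ => hf.lipschitzOnWith) ⟨by linarith, by linarith⟩
      (fun t ht => ⟨hderiv n t ht, trivial⟩) (fun t ht => ⟨hderiv m t (hsub ht), trivial⟩)
      ((hα0 n).trans (hα0 m).symm)
  -- The local curves are glued. The index jumps with `t`, but by `hagree` the value near `t` is
  -- that of the single curve `α n`.
  refine ⟨fun t => α ⌈|t|⌉₊ t, by simp [hα0], fun t => ?_⟩
  set n := ⌈|t|⌉₊ with hn
  have hmem : ∀ s : ℝ, s ∈ Ioo (-((⌈|s|⌉₊ : ℝ) + 1)) (⌈|s|⌉₊ + 1) := fun s => by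
    have := abs_le.1 (Nat.le_ceil |s|)
    exact ⟨by linarith, by linarith⟩
  refine (hderiv n t (hmem t)).congr_of_eventuallyEq ?_
  filter_upwards [Ioo_mem_nhds (hmem t).1 (hmem t).2] with s hs
  rcases le_total ⌈|s|⌉₊ n with h | h
  · exact hagree _ _ h s (hmem s)
  · exact (hagree _ _ h s hs).symm

/-- A Lyapunov estimate with a trapping region: if `V` is comparable to `g ^ 2` and decays
exponentially as long as `g < ρ`, then a sufficiently small initial value of `g` keeps `g` below
`ρ` and makes it decay exponentially. -/
theorem exp_decay_of_lyapunov {g V : ℝ → ℝ} {T ρ m M c : ℝ} (hm : 0 < m)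
    (hρ : 0 < ρ) (hg : ContinuousOn g (Ico 0 T)) (hV : ContinuousOn V (Ico 0 T))
    (hlow : ∀ t ∈ Ico 0 T, g t ≤ ρ → m * g t ^ 2 ≤ V t)
    (hup : V 0 ≤ M * g 0 ^ 2) (hc : 0 ≤ c)
    (hd : ∀ t ∈ Ioo 0 T, g t < ρ → ∃ v, HasDerivAt V v t ∧ v ≤ -c * V t)
    (h0 : M * g 0 ^ 2 < m * ρ ^ 2) (h0' : g 0 < ρ) :
    ∀ t ∈ Ico 0 T, g t < ρ ∧ m * g t ^ 2 ≤ Real.exp (-c * t) * (M * g 0 ^ 2) := by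
  -- Below the threshold, `exp (c * s) * V s` is nonincreasing.
  have key : ∀ t ∈ Ico 0 T, (∀ s ∈ Ioo 0 t, g s < ρ) → V t ≤ Real.exp (-c * t) * V 0 := by
    intro t ht hs
    have hsub : Icc 0 t ⊆ Ico 0 T := fun s hs => ⟨hs.1, hs.2.trans_lt ht.2⟩
    have hanti : AntitoneOn (fun s => Real.exp (c * s) * V s) (Icc 0 t) := by
      have hder : ∀ s ∈ Ioo 0 t, ∃ w, HasDerivAt (fun s => Real.exp (c * s) * V s) w s ∧
          w ≤ 0 := by
        intro s hs'
        obtain ⟨v, hv, hvle⟩ := hd s ⟨hs'.1, hs'.2.trans ht.2⟩ (hs s hs')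
        have h1 : HasDerivAt (fun s : ℝ => Real.exp (c * s)) (Real.exp (c * s) * c) s := by
          simpa using ((hasDerivAt_id s).const_mul c).exp
        refine ⟨_, h1.mul hv, ?_⟩
        nlinarith [Real.exp_pos (c * s)]
      refine antitoneOn_of_deriv_nonpos (convex_Icc 0 t) ?_ ?_ ?_
      · exact ContinuousOn.mul (by fun_prop) (hV.mono hsub)
      · rw [interior_Icc]
        intro s hs'
        obtain ⟨w, hw, -⟩ := hder s hs'
        exact hw.differentiableAt.differentiableWithinAt
      · rw [interior_Icc]
        intro s hs'
        obtain ⟨w, hw, hw0⟩ := hder s hs'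
        rwa [hw.deriv]
    have := hanti (left_mem_Icc.2 ht.1) (right_mem_Icc.2 ht.1) ht.1
    simp only [mul_zero, Real.exp_zero, one_mul] at this
    rw [neg_mul, Real.exp_neg, ← div_eq_inv_mul, le_div_iff₀ (Real.exp_pos _)]
    linarith
  have htrap : ∀ t ∈ Ico 0 T, g t < ρ := by
    intro t₁ ht₁
    by_contra! hge
    have hsub : Icc 0 t₁ ⊆ Ico 0 T := fun s hs => ⟨hs.1, hs.2.trans_lt ht₁.2⟩
    -- At the first time `t₀` with `g t₀ ≥ ρ`, continuity gives equality, and then `m ρ² ≤ V t₀ ≤ V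
    -- 0 ≤ M (g 0)² < m ρ²`, a contradiction.
    have hcomp : IsCompact (Icc 0 t₁ ∩ g ⁻¹' Ici ρ) :=
      isCompact_Icc.of_isClosed_subset
        ((hg.mono hsub).preimage_isClosed_of_isClosed isClosed_Icc isClosed_Ici) inter_subset_left
    obtain ⟨t₀, ⟨ht₀, hgt₀⟩, hmin⟩ := hcomp.exists_isLeast ⟨t₁, right_mem_Icc.2 ht₁.1, hge⟩
    have hbelow : ∀ s ∈ Icc 0 t₁, s < t₀ → g s < ρ := fun s hs hst => by
      by_contra! h
      exact absurd (hmin ⟨hs, h⟩) (not_le.2 hst)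
    have hsub0 : Icc 0 t₀ ⊆ Icc 0 t₁ := Icc_subset_Icc_right ht₀.2
    obtain ⟨u, hu, hgu⟩ := intermediate_value_Icc ht₀.1 (hg.mono (hsub0.trans hsub))
      ⟨h0'.le, hgt₀⟩
    have hut : u = t₀ := le_antisymm hu.2 (hmin ⟨hsub0 hu, hgu.ge⟩)
    subst hut
    have hk := key u (hsub (hsub0 hu))
      fun s hs => hbelow s (hsub0 (Ioo_subset_Icc_self hs)) hs.2
    have hl := hlow u (hsub (hsub0 hu)) hgu.le
    rw [hgu] at hl
    have he : Real.exp (-c * u) ≤ 1 := Real.exp_le_one_iff.2 (by nlinarith [hu.1])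
    have hmρ : 0 < m * ρ ^ 2 := by positivity
    have hV0 : 0 ≤ V 0 := by
      have := hlow 0 (hsub (hsub0 (left_mem_Icc.2 hu.1))) h0'.le
      nlinarith [sq_nonneg (g 0)]
    nlinarith
  intro t ht
  refine ⟨htrap t ht, (hlow t ht (htrap t ht).le).trans ?_⟩
  refine (key t ht fun s hs => htrap s ⟨hs.1.le, hs.2.trans ht.2⟩).trans ?_
  gcongr

/-- A continuous, positive definite, quadratically homogeneous function on a finite-dimensional
space is comparable to the square of the norm. -/
theorem exists_sq_norm_bounds {E : Type*} [NormedAddCommGroup E] [NormedSpace ℝ E]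
    [FiniteDimensional ℝ E] [Nontrivial E] {q : E → ℝ} (hq : Continuous q)
    (hhom : ∀ (a : ℝ) x, q (a • x) = a ^ 2 * q x) (hpos : ∀ x, x ≠ 0 → 0 < q x) :
    ∃ m > 0, ∃ M > 0, ∀ x, m * ‖x‖ ^ 2 ≤ q x ∧ q x ≤ M * ‖x‖ ^ 2 := by
  have hS : IsCompact (Metric.sphere (0 : E) 1) := isCompact_sphere 0 1
  have hne : (Metric.sphere (0 : E) 1).Nonempty := NormedSpace.sphere_nonempty.2 zero_le_one
  obtain ⟨a, ha, hamin⟩ := hS.exists_isMinOn hne hq.continuousOn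
  obtain ⟨b, hb, hbmax⟩ := hS.exists_isMaxOn hne hq.continuousOn
  have hne0 : ∀ x ∈ Metric.sphere (0 : E) 1, x ≠ 0 := by
    rintro x hx rfl
    simp at hx
  refine ⟨q a, hpos a (hne0 a ha), q b, hpos b (hne0 b hb), fun x => ?_⟩
  rcases eq_or_ne x 0 with rfl | hx
  · have : q (0 : E) = 0 := by simpa using hhom 0 0
    simp [this]
  have hxn : 0 < ‖x‖ := norm_pos_iff.2 hx
  have hmem : ‖x‖⁻¹ • x ∈ Metric.sphere (0 : E) 1 := by
    simp [norm_smul, hxn.ne']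
  have hqx : q x = ‖x‖ ^ 2 * q (‖x‖⁻¹ • x) := by
    rw [← hhom, smul_smul, mul_inv_cancel₀ hxn.ne', one_smul]
  have h1 : q a ≤ q (‖x‖⁻¹ • x) := hamin hmem
  have h2 : q (‖x‖⁻¹ • x) ≤ q b := hbmax hmem
  rw [hqx]
  constructor <;> nlinarith [sq_nonneg ‖x‖]

/-! ### Schur complements, definiteness and inverse positivity -/

namespace Matrix

variable {m n : Type*} [Fintype m] [DecidableEq m] [Fintype n] [DecidableEq n]

/-- The semidefinite version of the criterion upgrades to the definite one because the determinant
of the block matrix is `det D` times that of the Schur complement. -/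
theorem PosDef.fromBlocks₂₂_iff {A : Matrix m m ℝ} {B : Matrix m n ℝ} {D : Matrix n n ℝ}
    (hD : D.PosDef) :
    (fromBlocks A B Bᵀ D).PosDef ↔ (A - B * D⁻¹ * Bᵀ).PosDef := by
  have := hD.isUnit.invertible
  have hdet : (fromBlocks A B Bᵀ D).det = D.det * (A - B * D⁻¹ * Bᵀ).det := by
    rw [det_fromBlocks₂₂, invOf_eq_nonsing_inv]
  have hsemi := PosDef.fromBlocks₂₂ A B hD
  rw [conjTranspose_eq_transpose_of_trivial] at hsemi
  have hne := hD.det_pos.ne'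
  constructor <;> intro h
  · refine (hsemi.1 h.posSemidef).posDef_iff_det_ne_zero.2 fun h0 => h.det_pos.ne' ?_
    rw [hdet, h0, mul_zero]
  · refine (hsemi.2 h.posSemidef).posDef_iff_det_ne_zero.2 ?_
    rw [hdet]
    exact mul_ne_zero hne h.det_pos.ne'

theorem neg_inv_of_isUnit_det {D : Matrix n n ℝ} (h : IsUnit (-D).det) : (-D)⁻¹ = -D⁻¹ := by
  have h' : IsUnit D.det := by
    rw [← isUnit_iff_isUnit_det] at h ⊢
    exact (IsUnit.neg_iff D).1 h
  exact inv_eq_left_inv (by rw [neg_mul_neg, nonsing_inv_mul _ h'])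

/-- Negative definiteness of a symmetric block matrix via the Schur complement. -/
theorem negDef_fromBlocks₂₂_iff {A : Matrix m m ℝ} {B : Matrix m n ℝ} {D : Matrix n n ℝ}
    (hD : (-D).PosDef) :
    (-fromBlocks A B Bᵀ D).PosDef ↔ (-(A - B * D⁻¹ * Bᵀ)).PosDef := by
  have h := PosDef.fromBlocks₂₂_iff (A := -A) (B := -B) hD
  rw [neg_inv_of_isUnit_det ((isUnit_iff_isUnit_det _).1 hD.isUnit), transpose_neg,
    ← fromBlocks_neg] at h
  rw [h]
  congr! 1
  simp only [Matrix.neg_mul, Matrix.mul_neg, neg_neg]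
  abel

theorem negDef_fromBlocks₁₁_iff {A : Matrix m m ℝ} {B : Matrix m n ℝ} {D : Matrix n n ℝ}
    (hA : (-A).PosDef) :
    (-fromBlocks A B Bᵀ D).PosDef ↔ (-(D - Bᵀ * A⁻¹ * B)).PosDef := by
  have h := negDef_fromBlocks₂₂_iff (A := D) (B := Bᵀ) hA
  rw [transpose_transpose] at h
  rw [← h, ← fromBlocks_submatrix_sum_swap_sum_swap A]
  constructor <;> intro h'
  · have := h'.submatrix (e := Sum.swap) (Equiv.sumComm _ _).injective
    exact this
  · have := h'.submatrix (e := Sum.swap) (Equiv.sumComm _ _).injective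
    rw [submatrix_neg, Pi.neg_apply, Pi.neg_apply, submatrix_submatrix, Sum.swap_swap_eq,
      submatrix_id_id] at this
    exact this

theorem PosDef.neg_fromBlocks_toBlocks₁₁ {m n : Type*} {A : Matrix m m ℝ} {B : Matrix m n ℝ} {C : Matrix n m ℝ}
    {D : Matrix n n ℝ} (h : (-fromBlocks A B C D).PosDef) : (-A).PosDef :=
  h.submatrix (e := Sum.inl) Sum.inl_injective

theorem PosDef.neg_fromBlocks_toBlocks₂₂ {m n : Type*} {A : Matrix m m ℝ} {B : Matrix m n ℝ} {C : Matrix n m ℝ}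
    {D : Matrix n n ℝ} (h : (-fromBlocks A B C D).PosDef) : (-D).PosDef :=
  h.submatrix (e := Sum.inr) Sum.inr_injective

/-- A positive definite matrix with nonpositive off-diagonal entries is inverse-nonnegative. -/
theorem PosDef.nonneg_of_mulVec_nonneg {n : Type*} [Fintype n] {A : Matrix n n ℝ} (hA : A.PosDef)
    (hoff : ∀ i j, i ≠ j → A i j ≤ 0) {u : n → ℝ} (hu : ∀ i, 0 ≤ (A *ᵥ u) i) (i : n) :
    0 ≤ u i := by
  -- `v` is the negative part of `u` and `u + v` the positive part. Their supports are disjoint, so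
  -- only off-diagonal entries enter `v ⬝ᵥ A (u + v)`, which is thus nonpositive. Hence `v ⬝ᵥ A v ≤
  -- 0`, and `v = 0`.
  set v : n → ℝ := fun i => max (-u i) 0 with hv
  have hv0 : ∀ i, 0 ≤ v i := fun i => le_max_right _ _
  have hle : ∀ i j, v i * A i j * (u j + v j) ≤ 0 := by
    intro i j
    have h1 : 0 ≤ u j + v j := by linarith [le_max_left (-u j) 0]
    rcases eq_or_ne i j with rfl | hij
    · have : v i * (u i + v i) = 0 := by
        rcases le_total (-u i) 0 with h | h <;> simp [hv, h]
      rw [mul_right_comm, this, zero_mul]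
    · exact mul_nonpos_of_nonpos_of_nonneg
        (mul_nonpos_of_nonneg_of_nonpos (hv0 i) (hoff i j hij)) h1
  have hvA : v ⬝ᵥ (A *ᵥ v) ≤ 0 := by
    have h1 : v ⬝ᵥ (A *ᵥ (u + v)) ≤ 0 := by
      simp only [dotProduct, mulVec, Finset.mul_sum, Pi.add_apply]
      exact Finset.sum_nonpos fun i _ => Finset.sum_nonpos fun j _ => by
        rw [← mul_assoc]; exact hle i j
    have h2 : 0 ≤ v ⬝ᵥ (A *ᵥ u) := Finset.sum_nonneg fun i _ => mul_nonneg (hv0 i) (hu i)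
    rw [mulVec_add, dotProduct_add] at h1
    linarith
  have hvz : v = 0 := by
    by_contra h
    have := hA.dotProduct_mulVec_pos h
    rw [star_trivial] at this
    linarith
  have := congrFun hvz i
  simp only [hv, Pi.zero_apply] at this
  linarith [le_max_left (-u i) 0]

/-- If `u i = 0`, only the nonpositive off-diagonal entries contribute to `(A *ᵥ u) i`, since `u ≥
0`. -/
theorem PosDef.pos_of_mulVec_pos {n : Type*} [Fintype n] {A : Matrix n n ℝ} (hA : A.PosDef)
    (hoff : ∀ i j, i ≠ j → A i j ≤ 0) {u : n → ℝ} (hu : ∀ i, 0 < (A *ᵥ u) i) (i : n) :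
    0 < u i := by
  have h0 := hA.nonneg_of_mulVec_nonneg hoff fun i => (hu i).le
  refine (h0 i).lt_of_ne fun hi => (hu i).not_ge ?_
  refine Finset.sum_nonpos fun j _ => ?_
  rcases eq_or_ne i j with rfl | hij
  · simp [← hi]
  · exact mul_nonpos_of_nonpos_of_nonneg (hoff i j hij) (h0 j)

end Matrix

/-- A real eigenvector of the symmetric matrix is also a complex one, so the spectral condition
makes every real eigenvalue positive. -/
theorem IsMMatrix.posDef {ι : Type*} [Fintype ι] [DecidableEq ι] {A : Matrix ι ι ℝ}
    (hA : IsMMatrix A) (hsymm : A.IsHermitian) : A.PosDef := by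
  rw [hsymm.posDef_iff_eigenvalues_pos]
  intro i
  have hv := hsymm.mulVec_eigenvectorBasis i
  set v : ι → ℝ := ⇑(hsymm.eigenvectorBasis i) with hvdef
  have hv0 : v ≠ 0 := by
    intro h
    apply hsymm.eigenvectorBasis.orthonormal.ne_zero i
    ext j
    exact congrFun h j
  have := hA.2 (hsymm.eigenvalues i : ℂ) ?_
  · simpa using this
  refine Module.End.hasEigenvalue_of_hasEigenvector (x := fun j => (v j : ℂ)) ?_
  rw [Module.End.hasEigenvector_iff, Module.End.mem_eigenspace_iff]
  refine ⟨?_, fun h => hv0 ?_⟩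
  · ext j
    have := congrArg (fun r : ℝ => (r : ℂ)) (congrFun hv j)
    simpa [mulVec, dotProduct] using this
  · ext j
    simpa using congrFun h j

/-! ### Negative definiteness of the network matrices -/

namespace Microgrid

variable {L I : Type*} [Fintype L] [DecidableEq L] [Fintype I] [DecidableEq I]

theorem b_nonpos {L I : Type*} (M : Microgrid L I) (i j : L ⊕ I) : M.b i j ≤ 0 := by
  by_cases h : M.graph.Adj i j
  · exact (M.b_neg i j h).le
  · exact (M.b_zero i j h).le

theorem B_transpose (M : Microgrid L I) : M.Bᵀ = M.B := by
  ext i j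
  by_cases h : i = j
  · subst h; rfl
  · simp [B, h, Ne.symm h, M.b_symm i j]

theorem BIL_eq (M : Microgrid L I) : M.BIL = M.BLIᵀ := by
  ext i j
  exact (congrFun (congrFun M.B_transpose (Sum.inr i)) (Sum.inl j)).symm

theorem B_nonneg_of_ne (M : Microgrid L I) {i j : L ⊕ I} (h : i ≠ j) : 0 ≤ M.B i j := by
  simp [B, h, M.b_nonpos]

theorem B_eq_fromBlocks (M : Microgrid L I) : M.B = fromBlocks M.BLL M.BLI M.BLIᵀ M.BII := by
  rw [← BIL_eq]
  exact (fromBlocks_toBlocks M.B).symm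

theorem B_mulVec (M : Microgrid L I) (x : L ⊕ I → ℝ) (i : L ⊕ I) :
    (M.B *ᵥ x) i = ∑ j, M.b i j * (x i - x j) := by
  rw [mulVec, dotProduct, ← Finset.add_sum_erase _ _ (Finset.mem_univ i),
    ← Finset.add_sum_erase _ (fun j => M.b i j * (x i - x j)) (Finset.mem_univ i)]
  have hdiag : M.B i i = ∑ k ∈ Finset.univ.erase i, M.b i k := if_pos rfl
  rw [hdiag, Finset.sum_mul, ← Finset.sum_add_distrib, sub_self, mul_zero, zero_add]
  refine Finset.sum_congr rfl fun j hj => ?_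
  have : M.B i j = -M.b i j := if_neg (Finset.ne_of_mem_erase hj).symm
  rw [this]
  ring

/-- The Dirichlet form of the network, obtained by averaging the double sum with its image under
exchange of `i` and `j`. -/
theorem dotProduct_B_mulVec (M : Microgrid L I) (x : L ⊕ I → ℝ) :
    2 * (x ⬝ᵥ (M.B *ᵥ x)) = ∑ i, ∑ j, M.b i j * (x i - x j) ^ 2 := by
  have h1 : x ⬝ᵥ (M.B *ᵥ x) = ∑ i, ∑ j, x i * (M.b i j * (x i - x j)) := by
    simp only [dotProduct, B_mulVec, Finset.mul_sum]
  have h2 : x ⬝ᵥ (M.B *ᵥ x) = ∑ i, ∑ j, x j * (M.b i j * (x j - x i)) := by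
    rw [h1, Finset.sum_comm]
    refine Finset.sum_congr rfl fun i _ => Finset.sum_congr rfl fun j _ => ?_
    rw [M.b_symm]
  rw [two_mul]
  nth_rewrite 1 [h1]
  rw [h2, ← Finset.sum_add_distrib]
  refine Finset.sum_congr rfl fun i _ => ?_
  rw [← Finset.sum_add_distrib]
  exact Finset.sum_congr rfl fun j _ => by ring

/-- The network matrix with the inverter gains on the diagonal is negative definite. -/
theorem negDef_gain (M : Microgrid L I) [Nonempty I] :
    (-fromBlocks M.BLL M.BLI M.BLIᵀ (M.BII + M.KI)).PosDef := by
  have hdecomp : fromBlocks M.BLL M.BLI M.BLIᵀ (M.BII + M.KI) =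
      M.B + diagonal (Sum.elim 0 M.K) := by
    rw [B_eq_fromBlocks, KI, ← fromBlocks_diagonal, fromBlocks_add]
    simp
  rw [hdecomp]
  refine .of_dotProduct_mulVec_pos ?_ fun x hx => ?_
  · rw [IsHermitian, conjTranspose_eq_transpose_of_trivial, transpose_neg, transpose_add,
      B_transpose, diagonal_transpose]
  have hterm : ∀ i j, M.b i j * (x i - x j) ^ 2 ≤ 0 := fun i j =>
    mul_nonpos_of_nonpos_of_nonneg (M.b_nonpos i j) (sq_nonneg _)
  have hB : ∑ i, ∑ j, M.b i j * (x i - x j) ^ 2 ≤ 0 :=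
    Finset.sum_nonpos fun i _ => Finset.sum_nonpos fun j _ => hterm i j
  have hKterm : ∀ i, M.K i * x (Sum.inr i) ^ 2 ≤ 0 := fun i =>
    mul_nonpos_of_nonpos_of_nonneg (M.K_neg i).le (sq_nonneg _)
  have hK : ∑ i, M.K i * x (Sum.inr i) ^ 2 ≤ 0 := Finset.sum_nonpos fun i _ => hKterm i
  have hq : star x ⬝ᵥ (-(M.B + diagonal (Sum.elim 0 M.K)) *ᵥ x) =
      -((∑ i, ∑ j, M.b i j * (x i - x j) ^ 2) / 2 + ∑ i, M.K i * x (Sum.inr i) ^ 2) := by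
    rw [star_trivial, neg_mulVec, add_mulVec, dotProduct_neg, dotProduct_add,
      ← dotProduct_B_mulVec]
    have : x ⬝ᵥ (diagonal (Sum.elim 0 M.K) *ᵥ x) = ∑ i, M.K i * x (Sum.inr i) ^ 2 := by
      simp only [dotProduct, mulVec_diagonal, Fintype.sum_sum_type, Sum.elim_inl, Sum.elim_inr,
        Pi.zero_apply, zero_mul, mul_zero, Finset.sum_const_zero, zero_add]
      exact Finset.sum_congr rfl fun i _ => by ring
    rw [this]
    ring
  rw [hq]
  by_contra! hle
  -- Both sums are nonpositive, so both vanish: `x` is constant along branches, hence constant by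
  -- connectedness, and the gain of one inverter forces the constant to be 0.
  have hB0 : ∑ i, ∑ j, M.b i j * (x i - x j) ^ 2 = 0 := by linarith
  have hK0 : ∑ i, M.K i * x (Sum.inr i) ^ 2 = 0 := by linarith
  have hadj : ∀ i j, M.graph.Adj i j → x i = x j := by
    intro i j hij
    have h1 := (Finset.sum_eq_zero_iff_of_nonpos
      fun i _ => Finset.sum_nonpos fun j _ => hterm i j).1 hB0 i (Finset.mem_univ i)
    have h2 := (Finset.sum_eq_zero_iff_of_nonpos fun j _ => hterm i j).1 h1 j (Finset.mem_univ j)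
    have h3 := (mul_eq_zero.1 h2).resolve_left (M.b_neg i j hij).ne
    exact sub_eq_zero.1 (pow_eq_zero_iff two_ne_zero |>.1 h3)
  have hreach : ∀ i j, x i = x j := fun i j => by
    obtain ⟨w⟩ := M.connected.preconnected i j
    induction w with
    | nil => rfl
    | cons h _ ih => exact (hadj _ _ h).trans ih
  obtain ⟨k⟩ := ‹Nonempty I›
  have h1 := (Finset.sum_eq_zero_iff_of_nonpos fun i _ => hKterm i).1 hK0 k (Finset.mem_univ k)
  have h2 := (mul_eq_zero.1 h1).resolve_left (M.K_neg k).ne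
  have h3 : x (Sum.inr k) = 0 := pow_eq_zero_iff two_ne_zero |>.1 h2
  exact hx (funext fun i => (hreach i (Sum.inr k)).trans h3)

theorem negDef_BII_add_KI (M : Microgrid L I) [Nonempty I] : (-(M.BII + M.KI)).PosDef :=
  M.negDef_gain.neg_fromBlocks_toBlocks₂₂

theorem negDef_Bred (M : Microgrid L I) [Nonempty I] : (-M.Bred).PosDef := by
  rw [Bred, BIL_eq]
  exact (negDef_fromBlocks₂₂_iff M.negDef_BII_add_KI).1 M.negDef_gain

/-- The network matrix with shunt susceptances at the loads and gains at the inverters is negative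
definite if its Schur complement on the loads is the negative of an M-matrix. -/
theorem negDef_shunt (M : Microgrid L I) [Nonempty I] {bshunt : L → ℝ}
    (hM : IsMMatrix (-(M.Bred + diagonal bshunt))) :
    (-(M.Bred + diagonal bshunt)).PosDef ∧
    (-fromBlocks (M.BLL + diagonal bshunt) M.BLI M.BLIᵀ (M.BII + M.KI)).PosDef := by
  have h1 : (-(M.Bred + diagonal bshunt)).PosDef := by
    refine hM.posDef ?_
    rw [neg_add]
    exact M.negDef_Bred.1.add (isHermitian_diagonal _).neg
  refine ⟨h1, (negDef_fromBlocks₂₂_iff M.negDef_BII_add_KI).2 ?_⟩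
  rwa [add_sub_right_comm, ← BIL_eq]

end Microgrid

/-! ### The equilibrium, its positivity and its uniqueness -/

namespace Microgrid

variable {L I : Type*} [Fintype L] [DecidableEq L] [Fintype I] [DecidableEq I]

theorem isUnit_det_BII_add_KI (M : Microgrid L I) [Nonempty I] :
    IsUnit (M.BII + M.KI).det := by
  rw [← isUnit_iff_isUnit_det]
  exact (IsUnit.neg_iff _).1 M.negDef_BII_add_KI.isUnit

theorem isUnit_det_Bred (M : Microgrid L I) [Nonempty I] : IsUnit M.Bred.det := by
  rw [← isUnit_iff_isUnit_det]
  exact (IsUnit.neg_iff _).1 M.negDef_Bred.isUnit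

theorem isUnit_det_Bred_add_diagonal (M : Microgrid L I) [Nonempty I] {bshunt : L → ℝ}
    (hM : IsMMatrix (-(M.Bred + diagonal bshunt))) :
    IsUnit (M.Bred + diagonal bshunt).det := by
  rw [← isUnit_iff_isUnit_det]
  exact (IsUnit.neg_iff _).1 (M.negDef_shunt hM).1.isUnit

theorem BII_add_KI_mulVec_inverterVoltages (M : Microgrid L I) [Nonempty I] (EL : L → ℝ) :
    (M.BII + M.KI) *ᵥ M.inverterVoltages EL = M.KI *ᵥ M.Estar - M.BIL *ᵥ EL := by
  rw [inverterVoltages, W₂, mulVec_mulVec, ← Matrix.mul_assoc,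
    mul_nonsing_inv _ M.isUnit_det_BII_add_KI, Matrix.one_mul, fromCols_mulVec, neg_mulVec]
  simp only [Sum.elim_comp_inl, Sum.elim_comp_inr]
  abel

theorem Bred_mulVec_openCircuit (M : Microgrid L I) [Nonempty I] :
    M.Bred *ᵥ M.openCircuit = -(M.BLI *ᵥ ((M.BII + M.KI)⁻¹ *ᵥ (M.KI *ᵥ M.Estar))) := by
  rw [openCircuit, W₁, mulVec_mulVec, Matrix.mul_neg, neg_mulVec]
  simp only [← Matrix.mul_assoc, mul_nonsing_inv _ M.isUnit_det_Bred, Matrix.one_mul,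
    mulVec_mulVec]

theorem Bred_add_diagonal_mulVec_ziVoltage (M : Microgrid L I) [Nonempty I] {bshunt : L → ℝ}
    (hM : IsMMatrix (-(M.Bred + diagonal bshunt))) (Ishunt : L → ℝ) :
    (M.Bred + diagonal bshunt) *ᵥ M.ziVoltage bshunt Ishunt =
      M.Bred *ᵥ M.openCircuit - Ishunt := by
  rw [ziVoltage, mulVec_mulVec, mul_nonsing_inv _ (M.isUnit_det_Bred_add_diagonal hM),
    one_mulVec]

/-- The load equations, divided by the load voltages, at the equilibrium. -/
theorem load_balance (M : Microgrid L I) [Nonempty I] {bshunt : L → ℝ}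
    (hM : IsMMatrix (-(M.Bred + diagonal bshunt))) (Ishunt : L → ℝ) :
    (M.BLL + diagonal bshunt) *ᵥ M.ziVoltage bshunt Ishunt +
      M.BLI *ᵥ M.inverterVoltages (M.ziVoltage bshunt Ishunt) = -Ishunt := by
  have h1 := M.Bred_add_diagonal_mulVec_ziVoltage hM Ishunt
  set e := M.ziVoltage bshunt Ishunt
  have h2 : M.inverterVoltages e =
      (M.BII + M.KI)⁻¹ *ᵥ (M.KI *ᵥ M.Estar - M.BIL *ᵥ e) := by
    rw [← BII_add_KI_mulVec_inverterVoltages, mulVec_mulVec,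
      nonsing_inv_mul _ M.isUnit_det_BII_add_KI, one_mulVec]
  rw [Bred_mulVec_openCircuit, add_mulVec, Bred, sub_mulVec] at h1
  rw [h2, add_mulVec, mulVec_sub, mulVec_sub]
  simp only [mulVec_mulVec, Matrix.mul_assoc] at h1 ⊢
  rw [← sub_eq_zero] at h1 ⊢
  rw [← h1]
  abel

theorem mulVec_inl (M : Microgrid L I) (E : L ⊕ I → ℝ) (i : L) :
    (M.B *ᵥ E) (Sum.inl i) = (M.BLL *ᵥ (E ∘ Sum.inl) + M.BLI *ᵥ (E ∘ Sum.inr)) i := by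
  rw [B_eq_fromBlocks, fromBlocks_mulVec]
  rfl

theorem mulVec_inr (M : Microgrid L I) (E : L ⊕ I → ℝ) (i : I) :
    (M.B *ᵥ E) (Sum.inr i) = (M.BIL *ᵥ (E ∘ Sum.inl) + M.BII *ᵥ (E ∘ Sum.inr)) i := by
  rw [B_eq_fromBlocks, fromBlocks_mulVec, BIL_eq]
  rfl

/-- With ZI loads, the load equations are linear in the deviation from the equilibrium, up to the
factor `E i`. -/
theorem closedLoopRHS_inl (M : Microgrid L I) [Nonempty I] {bshunt : L → ℝ}
    (hM : IsMMatrix (-(M.Bred + diagonal bshunt))) (Ishunt : L → ℝ) (E : L ⊕ I → ℝ) (i : L) :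
    M.closedLoopRHS (ziLoad bshunt Ishunt) E (Sum.inl i) = E (Sum.inl i) *
      ((M.BLL + diagonal bshunt) *ᵥ (E ∘ Sum.inl - M.ziVoltage bshunt Ishunt) +
        M.BLI *ᵥ (E ∘ Sum.inr - M.inverterVoltages (M.ziVoltage bshunt Ishunt))) i := by
  have h := congrFun (M.load_balance hM Ishunt) i
  rw [mulVec_sub, mulVec_sub]
  simp only [closedLoopRHS, Pi.add_apply, Sum.elim_inl, mulVec_diagonal, mulVec_inl, ziLoad,
    Pi.sub_apply, add_mulVec, Pi.neg_apply, Function.comp_apply] at h ⊢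
  linear_combination E (Sum.inl i) * h

theorem closedLoopRHS_inr (M : Microgrid L I) [Nonempty I] (bshunt Ishunt : L → ℝ)
    (E : L ⊕ I → ℝ) (i : I) :
    M.closedLoopRHS (ziLoad bshunt Ishunt) E (Sum.inr i) = E (Sum.inr i) *
      (M.BIL *ᵥ (E ∘ Sum.inl - M.ziVoltage bshunt Ishunt) + (M.BII + M.KI) *ᵥ
        (E ∘ Sum.inr - M.inverterVoltages (M.ziVoltage bshunt Ishunt))) i := by
  have h := congrFun (M.BII_add_KI_mulVec_inverterVoltages (M.ziVoltage bshunt Ishunt)) i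
  rw [mulVec_sub, mulVec_sub]
  simp only [closedLoopRHS, Pi.add_apply, Sum.elim_inr, mulVec_diagonal, mulVec_inr, KI,
    Pi.sub_apply, add_mulVec, Function.comp_apply] at h ⊢
  linear_combination E (Sum.inr i) * h

theorem isEquilibrium_zi (M : Microgrid L I) [Nonempty I] {bshunt : L → ℝ}
    (hM : IsMMatrix (-(M.Bred + diagonal bshunt))) (Ishunt : L → ℝ) :
    M.IsEquilibrium (ziLoad bshunt Ishunt) (Sum.elim (M.ziVoltage bshunt Ishunt)
        (M.inverterVoltages (M.ziVoltage bshunt Ishunt))) := by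
  funext i
  cases i with
  | inl i => rw [closedLoopRHS_inl M hM]; simp
  | inr i => rw [closedLoopRHS_inr]; simp

/-- Assumption (ii) says exactly that `-(M.Bred + diagonal bshunt)` sends this vector to a positive
one. -/
theorem ziVoltage_pos (M : Microgrid L I) [Nonempty I] {bshunt Ishunt : L → ℝ}
    (hM : IsMMatrix (-(M.Bred + diagonal bshunt)))
    (hI : ∀ i, (M.Bred *ᵥ M.openCircuit) i < Ishunt i) (i : L) :
    0 < M.ziVoltage bshunt Ishunt i := by
  refine (M.negDef_shunt hM).1.pos_of_mulVec_pos hM.1 (fun i => ?_) i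
  rw [neg_mulVec, M.Bred_add_diagonal_mulVec_ziVoltage hM]
  simpa using hI i

/-- Inverse positivity of `-(M.BII + M.KI)`: it sends the inverter voltages to `B_IL E_L - K_I
E_I^*`, which is positive since `B_IL ≥ 0` and `K_I < 0`. -/
theorem inverterVoltages_pos (M : Microgrid L I) [Nonempty I] {EL : L → ℝ}
    (hEL : ∀ i, 0 < EL i) (i : I) : 0 < M.inverterVoltages EL i := by
  refine M.negDef_BII_add_KI.pos_of_mulVec_pos (fun i j hij => ?_) (fun i => ?_) i
  · have : 0 ≤ M.BII i j := M.B_nonneg_of_ne (Sum.inr_injective.ne hij)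
    simpa [KI, hij] using this
  · rw [neg_mulVec, BII_add_KI_mulVec_inverterVoltages, Pi.neg_apply, Pi.sub_apply, KI,
      mulVec_diagonal, neg_sub, sub_pos]
    have h1 : 0 ≤ (M.BIL *ᵥ EL) i := Finset.sum_nonneg fun j _ =>
      mul_nonneg (M.B_nonneg_of_ne Sum.inr_ne_inl) (hEL j).le
    exact (mul_neg_of_neg_of_pos (M.K_neg i) (M.Estar_pos i)).trans_le h1

theorem reducedPowerFlow_iff (M : Microgrid L I) (bshunt Ishunt EL : L → ℝ) :
    M.ReducedPowerFlow (ziLoad bshunt Ishunt) EL ↔ ∀ i, EL i *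
      ((M.Bred + diagonal bshunt) *ᵥ EL - (M.Bred *ᵥ M.openCircuit - Ishunt)) i = 0 := by
  rw [ReducedPowerFlow, funext_iff]
  refine forall_congr' fun i => ?_
  rw [eq_comm]
  simp only [ziLoad, mulVec_sub, add_mulVec, Pi.add_apply, mulVec_diagonal, Pi.sub_apply,
    Pi.zero_apply]
  ring_nf

theorem reducedPowerFlow_ziVoltage (M : Microgrid L I) [Nonempty I] {bshunt : L → ℝ}
    (hM : IsMMatrix (-(M.Bred + diagonal bshunt))) (Ishunt : L → ℝ) :
    M.ReducedPowerFlow (ziLoad bshunt Ishunt) (M.ziVoltage bshunt Ishunt) := by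
  rw [reducedPowerFlow_iff, M.Bred_add_diagonal_mulVec_ziVoltage hM]
  simp

theorem eq_ziVoltage_of_reducedPowerFlow (M : Microgrid L I) [Nonempty I]
    {bshunt Ishunt EL : L → ℝ} (hM : IsMMatrix (-(M.Bred + diagonal bshunt)))
    (hEL : ∀ i, 0 < EL i) (h : M.ReducedPowerFlow (ziLoad bshunt Ishunt) EL) :
    EL = M.ziVoltage bshunt Ishunt := by
  rw [reducedPowerFlow_iff] at h
  have h1 : (M.Bred + diagonal bshunt) *ᵥ EL = M.Bred *ᵥ M.openCircuit - Ishunt :=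
    sub_eq_zero.1 (funext fun i => (mul_eq_zero.1 (h i)).resolve_left (hEL i).ne')
  rw [ziVoltage, ← h1, mulVec_mulVec, nonsing_inv_mul _ (M.isUnit_det_Bred_add_diagonal hM),
    one_mulVec]

/-! ### Elimination of the load voltages -/

/-- The matrix of the dynamics of the inverter voltages after elimination of the load voltages:
the negative of the Schur complement of the network matrix on the inverters. -/
def inverterMatrix (M : Microgrid L I) (bshunt : L → ℝ) : Matrix I I ℝ :=
  -(M.BII + M.KI - M.BLIᵀ * (M.BLL + diagonal bshunt)⁻¹ * M.BLI)

/-- The matrix that expresses the deviation of the load voltages through that of the inverter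
voltages. -/
def loadMatrix (M : Microgrid L I) (bshunt : L → ℝ) : Matrix L I ℝ :=
  -((M.BLL + diagonal bshunt)⁻¹ * M.BLI)

/-- Definiteness of the full block matrix passes to its Schur complement on either block; here it is
transferred from the loads to the inverters. -/
theorem posDef_inverterMatrix (M : Microgrid L I) [Nonempty I] {bshunt : L → ℝ}
    (hM : IsMMatrix (-(M.Bred + diagonal bshunt))) : (M.inverterMatrix bshunt).PosDef :=
  (negDef_fromBlocks₁₁_iff (M.negDef_shunt hM).2.neg_fromBlocks_toBlocks₁₁).1
    (M.negDef_shunt hM).2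

theorem isUnit_det_BLL_add_diagonal (M : Microgrid L I) [Nonempty I] {bshunt : L → ℝ}
    (hM : IsMMatrix (-(M.Bred + diagonal bshunt))) :
    IsUnit (M.BLL + diagonal bshunt).det := by
  rw [← isUnit_iff_isUnit_det]
  exact (IsUnit.neg_iff _).1 (M.negDef_shunt hM).2.neg_fromBlocks_toBlocks₁₁.isUnit

theorem load_eq_zero_iff (M : Microgrid L I) [Nonempty I] {bshunt : L → ℝ}
    (hM : IsMMatrix (-(M.Bred + diagonal bshunt))) (u : L → ℝ) (y : I → ℝ) :
    (M.BLL + diagonal bshunt) *ᵥ u + M.BLI *ᵥ y = 0 ↔ u = M.loadMatrix bshunt *ᵥ y := by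
  have hu := M.isUnit_det_BLL_add_diagonal hM
  constructor <;> intro h
  · rw [loadMatrix, neg_mulVec, ← mulVec_mulVec, eq_neg_of_add_eq_zero_right h, mulVec_neg,
      neg_neg, mulVec_mulVec, nonsing_inv_mul _ hu, one_mulVec]
  · rw [h, loadMatrix, neg_mulVec, ← mulVec_mulVec, mulVec_neg, mulVec_mulVec,
      mul_nonsing_inv _ hu, one_mulVec, neg_add_cancel]

theorem inverter_reduction (M : Microgrid L I) (bshunt : L → ℝ) (y : I → ℝ) :
    M.BIL *ᵥ (M.loadMatrix bshunt *ᵥ y) + (M.BII + M.KI) *ᵥ y =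
      -(M.inverterMatrix bshunt *ᵥ y) := by
  rw [loadMatrix, inverterMatrix, neg_mulVec, neg_mulVec, neg_neg, sub_mulVec, BIL_eq, mulVec_neg]
  simp only [mulVec_mulVec, Matrix.mul_assoc]
  abel

end Microgrid

/-! ### Curves in a box and quadratic Lyapunov functions -/

/-- A continuously differentiable vector field on `ι → ℝ` has, from each initial value, a global
curve that is an integral curve as long as it stays in the box `‖x‖ ≤ ρ`. -/
theorem exists_curve_of_contDiff {ι : Type*} [Fintype ι] {f : (ι → ℝ) → ι → ℝ}
    (hf : ContDiff ℝ 1 f) {ρ : ℝ} (hρ : 0 ≤ ρ) (x₀ : ι → ℝ) :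
    ∃ γ : ℝ → ι → ℝ, γ 0 = x₀ ∧ Continuous γ ∧
      ∀ t, ‖γ t‖ ≤ ρ → HasDerivAt γ (f (γ t)) t := by
  have hle : -ρ ≤ ρ := by linarith
  -- Clamping each coordinate is nonexpansive for the sup norm, so `f ∘ π` is bounded and globally
  -- Lipschitz and agrees with `f` on the box.
  set π : (ι → ℝ) → ι → ℝ := fun x i => (projIcc (-ρ) ρ hle (x i) : ℝ) with hπ
  have hπlip : LipschitzWith 1 π := by
    refine LipschitzWith.of_dist_le_mul fun x y => ?_
    rw [NNReal.coe_one, one_mul, dist_pi_le_iff dist_nonneg]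
    intro i
    have := (LipschitzWith.projIcc hle).dist_le_mul (x i) (y i)
    rw [NNReal.coe_one, one_mul] at this
    exact this.trans (dist_le_pi_dist x y i)
  have hπmem : ∀ x, π x ∈ Metric.closedBall (0 : ι → ℝ) ρ := fun x => by
    rw [mem_closedBall_zero_iff, pi_norm_le_iff_of_nonneg hρ]
    exact fun i => abs_le.2 (projIcc (-ρ) ρ hle (x i)).2
  have hπid : ∀ x, ‖x‖ ≤ ρ → π x = x := fun x hx => funext fun i => by
    have := abs_le.1 ((norm_le_pi_norm x i).trans hx)
    exact congrArg Subtype.val (projIcc_of_mem hle this)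
  have hcomp : IsCompact (Metric.closedBall (0 : ι → ℝ) ρ) := isCompact_closedBall 0 ρ
  obtain ⟨K, hK⟩ := LocallyLipschitzOn.exists_lipschitzOnWith_of_compact hcomp
    (hf.locallyLipschitz.locallyLipschitzOn (s := Metric.closedBall 0 ρ))
  obtain ⟨N, hN⟩ := hcomp.exists_bound_of_continuousOn hf.continuous.continuousOn
  have hlip : LipschitzWith (K * 1) (f ∘ π) :=
    lipschitzOnWith_univ.1 (hK.comp hπlip.lipschitzOnWith fun x _ => hπmem x)
  obtain ⟨γ, h0, hγ⟩ := exists_integralCurve_of_bounded_lipschitz hlip (N := N.toNNReal)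
    (fun x => (hN _ (hπmem x)).trans (Real.le_coe_toNNReal N)) x₀
  refine ⟨γ, h0, continuous_iff_continuousAt.2 fun t => (hγ t).continuousAt, fun t ht => ?_⟩
  have := hγ t
  rwa [Function.comp_apply, hπid _ ht] at this

theorem hasDerivAt_dotProduct_mulVec {ι : Type*} [Fintype ι] {P : Matrix ι ι ℝ}
    (hP : Pᵀ = P) {y : ℝ → ι → ℝ} {v : ι → ℝ} {t : ℝ} (hy : HasDerivAt y v t) :
    HasDerivAt (fun s => y s ⬝ᵥ (P *ᵥ y s)) (2 * (v ⬝ᵥ (P *ᵥ y t))) t := by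
  rw [hasDerivAt_pi] at hy
  have h1 : ∀ i, HasDerivAt (fun s => (P *ᵥ y s) i) ((P *ᵥ v) i) t := fun i =>
    HasDerivAt.fun_sum fun j _ => (hy j).const_mul (P i j)
  have h2 : HasDerivAt (fun s => y s ⬝ᵥ (P *ᵥ y s))
      (∑ i, (v i * (P *ᵥ y t) i + y t i * (P *ᵥ v) i)) t :=
    HasDerivAt.fun_sum fun i _ => (hy i).mul (h1 i)
  convert h2 using 1
  rw [Finset.sum_add_distrib]
  change _ = v ⬝ᵥ (P *ᵥ y t) + y t ⬝ᵥ (P *ᵥ v)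
  have h3 : y t ⬝ᵥ (P *ᵥ v) = v ⬝ᵥ (P *ᵥ y t) := by
    rw [dotProduct_mulVec, ← mulVec_transpose, hP, dotProduct_comm]
  rw [h3]
  ring

/-- The quadratic form of a positive definite matrix `P` is a Lyapunov function for
`v = - [w] P y`, where `w` is bounded below by a positive constant. -/
theorem Matrix.PosDef.exists_lyapunov {ι : Type*} [Fintype ι] [DecidableEq ι] [Nonempty ι]
    {P : Matrix ι ι ℝ} (hP : P.PosDef) {δ : ℝ} (hδ : 0 < δ) :
    ∃ m > 0, ∃ M > 0, ∃ c > 0, ∀ y : ι → ℝ,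
      (m * ‖y‖ ^ 2 ≤ y ⬝ᵥ (P *ᵥ y) ∧ y ⬝ᵥ (P *ᵥ y) ≤ M * ‖y‖ ^ 2) ∧
      ∀ w v : ι → ℝ, (∀ i, δ ≤ w i) → (∀ i, v i = -(w i * (P *ᵥ y) i)) →
        2 * (v ⬝ᵥ (P *ᵥ y)) ≤ -c * (y ⬝ᵥ (P *ᵥ y)) := by
  have hcont : Continuous fun y : ι → ℝ => P *ᵥ y := continuous_const.matrix_mulVec continuous_id
  obtain ⟨m, hm, M, hM, hV⟩ := exists_sq_norm_bounds
    (q := fun y : ι → ℝ => y ⬝ᵥ (P *ᵥ y)) (continuous_id.dotProduct hcont)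
    (fun a x => by
      rw [mulVec_smul, dotProduct_smul, smul_dotProduct, smul_eq_mul, smul_eq_mul]; ring)
    (fun x hx => by simpa using hP.dotProduct_mulVec_pos hx)
  obtain ⟨m', hm', M', _, hz⟩ := exists_sq_norm_bounds
    (q := fun y : ι → ℝ => (P *ᵥ y) ⬝ᵥ (P *ᵥ y)) (hcont.dotProduct hcont)
    (fun a x => by
      rw [mulVec_smul, dotProduct_smul, smul_dotProduct, smul_eq_mul, smul_eq_mul]; ring)
    (fun x hx => by
      have h0 : P *ᵥ x ≠ 0 := fun h => by
        have := hP.dotProduct_mulVec_pos hx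
        simp [h] at this
      simpa using dotProduct_star_self_pos_iff.2 h0)
  -- The rate comes from the chain `V' ≤ -2 δ |P y|² ≤ -2 δ m' ‖y‖² ≤ -(2 δ m' / M) V`.
  refine ⟨m, hm, M, hM, 2 * δ * m' / M, by positivity, fun y => ⟨hV y, fun w v hw hv => ?_⟩⟩
  have h1 : v ⬝ᵥ (P *ᵥ y) ≤ -δ * ((P *ᵥ y) ⬝ᵥ (P *ᵥ y)) := by
    rw [dotProduct, dotProduct, Finset.mul_sum]
    refine Finset.sum_le_sum fun i _ => ?_
    rw [hv]
    nlinarith [hw i, mul_self_nonneg ((P *ᵥ y) i)]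
  have h2 := (hz y).1
  have h3 : (y ⬝ᵥ (P *ᵥ y)) / M ≤ ‖y‖ ^ 2 := by
    rw [div_le_iff₀ hM]
    linarith [(hV y).2]
  have h4 : -(2 * δ * m' / M) * (y ⬝ᵥ (P *ᵥ y)) = -(2 * δ) * (m' * ((y ⬝ᵥ (P *ᵥ y)) / M)) := by
    ring
  have h5 : m' * ((y ⬝ᵥ (P *ᵥ y)) / M) ≤ (P *ᵥ y) ⬝ᵥ (P *ᵥ y) :=
    (mul_le_mul_of_nonneg_left h3 hm'.le).trans h2
  rw [h4]
  nlinarith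

theorem exists_norm_mulVec_le {m n : Type*} [Fintype m] [Fintype n] (G : Matrix m n ℝ) :
    ∃ C ≥ 1, ∀ y : n → ℝ, ‖G *ᵥ y‖ ≤ C * ‖y‖ := by
  -- With a constant at least 1, the same bound covers both the load part `G y` and the inverter
  -- part `y` of a deviation.
  refine ⟨max 1 ‖G.mulVecLin.toContinuousLinearMap‖, le_max_left _ _, fun y => ?_⟩
  refine (G.mulVecLin.toContinuousLinearMap.le_opNorm y).trans ?_
  gcongr
  exact le_max_right _ _

theorem exists_pos_le {ι : Type*} [Finite ι] {f : ι → ℝ} (hf : ∀ i, 0 < f i) :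
    ∃ δ > 0, ∀ i, δ ≤ f i := by
  cases isEmpty_or_nonempty ι
  · exact ⟨1, one_pos, fun i => isEmptyElim i⟩
  · obtain ⟨i, hi⟩ := Finite.exists_min f
    exact ⟨f i, hf i, hi⟩

/-! ### Local exponential stability -/

namespace Microgrid

variable {L I : Type*} [Fintype L] [DecidableEq L] [Fintype I] [DecidableEq I]

/-- Positivity selects the linear branch: a load equation also holds trivially where its voltage is
zero. -/
theorem isConsistent_iff (M : Microgrid L I) [Nonempty I] {bshunt : L → ℝ}
    (hM : IsMMatrix (-(M.Bred + diagonal bshunt))) (Ishunt : L → ℝ) {E : L ⊕ I → ℝ}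
    (hE : ∀ i, 0 < E i) :
    M.IsConsistent (ziLoad bshunt Ishunt) E ↔
      E ∘ Sum.inl - M.ziVoltage bshunt Ishunt = M.loadMatrix bshunt *ᵥ
        (E ∘ Sum.inr - M.inverterVoltages (M.ziVoltage bshunt Ishunt)) := by
  rw [← M.load_eq_zero_iff hM, funext_iff, IsConsistent]
  refine forall_congr' fun i => ?_
  rw [M.closedLoopRHS_inl hM, mul_eq_zero_iff_left (hE _).ne', Pi.zero_apply]

/-- On consistent points, the dynamics of the inverter voltages has the form `-[E_I] P y`. -/
theorem closedLoopRHS_inr_of_load_eq (M : Microgrid L I) [Nonempty I] {bshunt Ishunt : L → ℝ}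
    {E : L ⊕ I → ℝ} (h : E ∘ Sum.inl - M.ziVoltage bshunt Ishunt = M.loadMatrix bshunt *ᵥ
        (E ∘ Sum.inr - M.inverterVoltages (M.ziVoltage bshunt Ishunt))) (i : I) :
    M.closedLoopRHS (ziLoad bshunt Ishunt) E (Sum.inr i) = -(E (Sum.inr i) *
      (M.inverterMatrix bshunt *ᵥ
        (E ∘ Sum.inr - M.inverterVoltages (M.ziVoltage bshunt Ishunt))) i) := by
  rw [closedLoopRHS_inr, h, inverter_reduction, Pi.neg_apply, mul_neg]

theorem isLocallyExponentiallyStable_zi (M : Microgrid L I) [Nonempty I]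
    {bshunt Ishunt : L → ℝ} (hM : IsMMatrix (-(M.Bred + diagonal bshunt)))
    (hI : ∀ i, (M.Bred *ᵥ M.openCircuit) i < Ishunt i) :
    M.IsLocallyExponentiallyStable (ziLoad bshunt Ishunt)
      (Sum.elim (M.ziVoltage bshunt Ishunt)
        (M.inverterVoltages (M.ziVoltage bshunt Ishunt))) := by
  refine ⟨M.isEquilibrium_zi hM Ishunt, ?_⟩
  have hcons := fun E hE => M.isConsistent_iff hM Ishunt (E := E) hE
  have hrhs := fun E h => M.closedLoopRHS_inr_of_load_eq (bshunt := bshunt) (Ishunt := Ishunt)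
    (E := E) h
  have heL := M.ziVoltage_pos hM hI
  have heI := M.inverterVoltages_pos heL
  set eL := M.ziVoltage bshunt Ishunt
  set eI := M.inverterVoltages eL
  set G := M.loadMatrix bshunt
  set P := M.inverterMatrix bshunt
  set e : L ⊕ I → ℝ := Sum.elim eL eI with he
  have hP : P.PosDef := M.posDef_inverterMatrix hM
  have hPT : Pᵀ = P := by simpa using hP.1.eq
  have hepos : ∀ i, 0 < e i := by rintro (i | i); exacts [heL i, heI i]
  obtain ⟨δ, hδ, hδe⟩ := exists_pos_le hepos
  -- Within distance `δ / 2` of the equilibrium every voltage stays at least `δ - δ / 2 = ρ`.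
  set ρ := δ / 2 with hρdef
  have hρ : 0 < ρ := half_pos hδ
  have hge : ∀ E : L ⊕ I → ℝ, ‖E - e‖ ≤ ρ → ∀ i, ρ ≤ E i := fun E hE i => by
    have := (abs_le.1 ((norm_le_pi_norm (E - e) i).trans hE)).1
    rw [Pi.sub_apply] at this
    linarith [hδe i]
  obtain ⟨σ, hσ, hστ⟩ := exists_pos_le fun i => div_pos hρ (M.τ_pos i)
  obtain ⟨m, hm, N, hN, c, hc, hlyap⟩ := hP.exists_lyapunov hσ
  obtain ⟨C, hC1, hC⟩ := exists_norm_mulVec_le G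
  have hC0 : 0 < C := zero_lt_one.trans_le hC1
  set V : (I → ℝ) → ℝ := fun y => y ⬝ᵥ (P *ᵥ y) with hVdef
  have hVcont : Continuous V :=
    continuous_id.dotProduct (continuous_const.matrix_mulVec continuous_id)
  have hinr : ∀ E : L ⊕ I → ℝ, ‖E ∘ Sum.inr - eI‖ ≤ ‖E - e‖ := fun E =>
    (pi_norm_le_iff_of_nonneg (norm_nonneg _)).2 fun i => norm_le_pi_norm (E - e) (Sum.inr i)
  have hdev : ∀ E : L ⊕ I → ℝ, E ∘ Sum.inl - eL = G *ᵥ (E ∘ Sum.inr - eI) →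
      ‖E - e‖ ≤ C * ‖E ∘ Sum.inr - eI‖ := fun E h => by
    refine (pi_norm_le_iff_of_nonneg (by positivity)).2 ?_
    rintro (i | i)
    · refine le_trans ?_ (hC _)
      rw [← h]
      exact norm_le_pi_norm (E ∘ Sum.inl - eL) i
    · refine le_trans (norm_le_pi_norm (E ∘ Sum.inr - eI) i) ?_
      exact le_mul_of_one_le_left (norm_nonneg _) hC1
  -- the lower bound of the Lyapunov function in terms of the whole deviation
  set m' := m / C ^ 2 with hm'def
  have hm' : 0 < m' := by positivity
  have hVlow : ∀ E : L ⊕ I → ℝ, E ∘ Sum.inl - eL = G *ᵥ (E ∘ Sum.inr - eI) →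
      m' * ‖E - e‖ ^ 2 ≤ V (E ∘ Sum.inr - eI) := fun E h => by
    refine le_trans ?_ (hlyap _).1.1
    rw [hm'def, div_mul_eq_mul_div, div_le_iff₀ (by positivity), mul_assoc]
    refine mul_le_mul_of_nonneg_left ?_ hm.le
    rw [← mul_pow, mul_comm _ C]
    exact pow_le_pow_left₀ (norm_nonneg _) (hdev E h) 2
  have hVderiv : ∀ E : L ⊕ I → ℝ, ‖E - e‖ ≤ ρ → E ∘ Sum.inl - eL = G *ᵥ (E ∘ Sum.inr - eI) →
      ∀ v : I → ℝ, (∀ i, M.τ i * v i =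
        M.closedLoopRHS (ziLoad bshunt Ishunt) E (Sum.inr i)) →
      2 * (v ⬝ᵥ (P *ᵥ (E ∘ Sum.inr - eI))) ≤ -c * V (E ∘ Sum.inr - eI) := by
    intro E hE h v hv
    refine (hlyap _).2 (fun i => E (Sum.inr i) / M.τ i) v (fun i => (hστ i).trans ?_) fun i => ?_
    · exact div_le_div_of_nonneg_right (hge E hE _) (M.τ_pos i).le
    · have h1 := hv i
      rw [hrhs E h] at h1
      have := (M.τ_pos i).ne'
      field_simp
      linarith
  -- The second term ensures `N s² < m' ρ²` for `s < r`, the smallness that the trapping argument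
  -- requires.
  set r := min ρ (ρ * √(m' / N)) with hrdef
  have hr : 0 < r := by positivity
  have hNr : ∀ s, 0 ≤ s → s < r → N * s ^ 2 < m' * ρ ^ 2 := fun s hs hsr => by
    have h1 : s ^ 2 < (ρ * √(m' / N)) ^ 2 :=
      pow_lt_pow_left₀ (hsr.trans_le (min_le_right _ _)) hs two_ne_zero
    rw [mul_pow, Real.sq_sqrt (by positivity)] at h1
    calc N * s ^ 2 < N * (ρ ^ 2 * (m' / N)) := by gcongr
      _ = m' * ρ ^ 2 := by field_simp
  -- The decay estimate bounds the squared norm; its square root gives the factor `√(N / m')` and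
  -- halves the rate.
  refine ⟨r, hr, √(N / m'), by positivity, c / 2, by positivity, fun x hx hxr => ⟨?_, ?_⟩⟩
  · have hxρ : ‖x - e‖ < ρ := hxr.trans_le (min_le_left _ _)
    have hxpos : ∀ i, 0 < x i := fun i => hρ.trans_le (hge x hxρ.le i)
    have hxload := (hcons x hxpos).1 hx
    set y₀ := x ∘ Sum.inr - eI with hy₀
    -- The inverter dynamics after substituting `u = G y`; a polynomial field, whose curve in the
    -- box is then lifted to all buses.
    set f : (I → ℝ) → I → ℝ := fun y i => -((eI i + y i) * (P *ᵥ y) i) / M.τ i with hf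
    have hfC : ContDiff ℝ 1 f := by
      rw [contDiff_pi]
      intro i
      simp only [hf, mulVec, dotProduct]
      fun_prop
    obtain ⟨y, hy0, hycont, hy⟩ := exists_curve_of_contDiff hfC hρ.le y₀
    set E : ℝ → L ⊕ I → ℝ := fun t => Sum.elim (eL + G *ᵥ y t) (eI + y t) with hE
    have hEinr : ∀ t, E t ∘ Sum.inr - eI = y t := fun t => by
      ext i; simp [hE]
    have hEinl : ∀ t, E t ∘ Sum.inl - eL = G *ᵥ (E t ∘ Sum.inr - eI) := fun t => by
      rw [hEinr]; ext i; simp [hE]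
    have hτf : ∀ t i, M.τ i * f (y t) i =
        M.closedLoopRHS (ziLoad bshunt Ishunt) (E t) (Sum.inr i) := fun t i => by
      rw [hrhs _ (hEinl t), hEinr, hf]
      have := (M.τ_pos i).ne'
      simp only [hE, Sum.elim_inr, Pi.add_apply]
      field_simp
    have hE0 : E 0 = x := by
      funext i
      cases i with
      | inl i =>
        have := congrFun hxload i
        simp only [hE, hy0, Sum.elim_inl, Pi.add_apply, ← this]
        simp
      | inr i => simp [hE, hy0, hy₀]
    have hEcont : Continuous E := by
      refine continuous_pi fun i => ?_
      have hGy : Continuous fun t => G *ᵥ y t := continuous_const.matrix_mulVec hycont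
      cases i with
      | inl i => exact continuous_const.add ((continuous_apply i).comp hGy)
      | inr i => exact continuous_const.add ((continuous_apply i).comp hycont)
    -- No circularity: the differential equation for `y` is needed only while `‖E s - e‖ < ρ`, where
    -- `‖y s‖ ≤ ρ` holds as well.
    have htrap : ∀ t, 0 ≤ t → ‖E t - e‖ < ρ := fun t ht => by
      have hVE : Continuous fun s => V (y s) := hVcont.comp hycont
      refine (exp_decay_of_lyapunov (g := fun s => ‖E s - e‖) (V := fun s => V (y s)) (T := t + 1)
        (m := m') (M := N) (c := c) hm' hρ
        (hEcont.sub continuous_const).norm.continuousOn hVE.continuousOn (fun s _ _ => ?_) ?_ hc.le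
        (fun s _ hs => ?_) ?_ ?_ t ⟨ht, by linarith⟩).1
      · have := hVlow (E s) (hEinl s)
        rwa [hEinr] at this
      · refine (hlyap (y 0)).1.2.trans ?_
        have := hinr (E 0)
        rw [hEinr] at this
        gcongr
      · have hys : ‖y s‖ ≤ ρ := by
          have := hinr (E s)
          rw [hEinr] at this
          exact this.trans hs.le
        refine ⟨_, hasDerivAt_dotProduct_mulVec hPT (hy s hys), ?_⟩
        have := hVderiv (E s) hs.le (hEinl s) (f (y s)) (hτf s)
        rwa [hEinr] at this
      · simp only [hE0]
        exact hNr _ (norm_nonneg _) hxr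
      · simpa only [hE0] using hxρ
    refine ⟨E, hE0, hEcont.continuousOn, fun t ht => ⟨?_, fun i => ?_⟩⟩
    · exact (hcons _ fun i => hρ.trans_le (hge _ (htrap t ht).le i)).2 (hEinl t)
    · refine ⟨f (y t) i, ?_, hτf t i⟩
      have hys : ‖y t‖ ≤ ρ := by
        have := hinr (E t)
        rw [hEinr] at this
        exact this.trans (htrap t ht).le
      exact ((hasDerivAt_pi.1 (hy t hys) i).const_add (eI i)).hasDerivWithinAt
  · intro T hT E hE0 ⟨hEcont, hEsol⟩ t ht
    -- An arbitrary solution satisfies the linear constraint only as long as its voltages are known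
    -- to be positive, hence the restriction to the `ρ`-ball.
    have hload : ∀ s ∈ Ico 0 T, ‖E s - e‖ ≤ ρ →
        E s ∘ Sum.inl - eL = G *ᵥ (E s ∘ Sum.inr - eI) := fun s hs hsρ =>
      (hcons _ fun i => hρ.trans_le (hge _ hsρ i)).1 (hEsol s hs).1
    have hycont : ContinuousOn (fun s => E s ∘ Sum.inr - eI) (Ico 0 T) :=
      (continuousOn_pi.2 fun i => (continuous_apply (Sum.inr i)).comp_continuousOn hEcont).sub
        continuousOn_const
    have hdecay := (exp_decay_of_lyapunov (g := fun s => ‖E s - e‖)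
      (V := fun s => V (E s ∘ Sum.inr - eI)) (T := T)
      (m := m') (M := N) (c := c) hm' hρ
      (hEcont.sub continuousOn_const).norm (hVcont.comp_continuousOn hycont)
      (fun s hs hsρ => hVlow _ (hload s hs hsρ))
      ((hlyap _).1.2.trans (by gcongr; exact hinr (E 0))) hc.le ?_ ?_ ?_ t ht).2
    · rw [hE0] at hdecay
      have hrw : (√(N / m') * Real.exp (-(c / 2) * t) * ‖x - e‖) ^ 2 =
          Real.exp (-c * t) * (N * ‖x - e‖ ^ 2) / m' := by
        rw [mul_pow, mul_pow, Real.sq_sqrt (by positivity), ← Real.exp_nat_mul,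
          show ((2 : ℕ) : ℝ) * (-(c / 2) * t) = -c * t by push_cast; ring]
        ring
      refine (pow_le_pow_iff_left₀ (norm_nonneg _) (by positivity) two_ne_zero).1 ?_
      rw [hrw, le_div_iff₀ hm', mul_comm]
      exact hdecay
    · intro s hs hsρ
      have hs' := Ioo_subset_Ico_self hs
      choose v hv hτv using (hEsol s hs').2
      have hyd : HasDerivAt (fun s => E s ∘ Sum.inr - eI) v s :=
        hasDerivAt_pi.2 fun i =>
          ((hv i).hasDerivAt (Ico_mem_nhds hs.1 hs.2)).sub_const (eI i)
      exact ⟨_, hasDerivAt_dotProduct_mulVec hPT hyd,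
        hVderiv (E s) hsρ.le (hload s hs' hsρ.le) v hτv⟩
    · simp only [hE0]
      exact hNr _ (norm_nonneg _) hxr
    · simpa only [hE0] using hxr.trans_le (min_le_left _ _)

end Microgrid

end

theorem theorem3 {L I : Type*} [Fintype L] [DecidableEq L] [Nonempty L]
    [Fintype I] [DecidableEq I] [Nonempty I] (M : Microgrid L I) (bshunt Ishunt : L → ℝ)
    (hM : IsMMatrix (-(M.Bred + Matrix.diagonal bshunt)))
    (hI : ∀ i, (M.Bred *ᵥ M.openCircuit) i < Ishunt i) :
    -- the matrix inverted in the formula for the solution is nonsingular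
    IsUnit (M.Bred + Matrix.diagonal bshunt).det ∧
    -- the formula gives a positive solution of the reduced power flow equation
    (∀ i, 0 < M.ziVoltage bshunt Ishunt i) ∧
    M.ReducedPowerFlow (ziLoad bshunt Ishunt) (M.ziVoltage bshunt Ishunt) ∧
    -- there is no other positive solution
    (∀ EL : L → ℝ, (∀ i, 0 < EL i) → M.ReducedPowerFlow (ziLoad bshunt Ishunt) EL →
      EL = M.ziVoltage bshunt Ishunt) ∧
    -- the associated inverter voltages are positive, and the resulting point is an equilibrium of
    -- the closed-loop system that is locally exponentially stable
    (∀ i, 0 < M.inverterVoltages (M.ziVoltage bshunt Ishunt) i) ∧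
    M.IsLocallyExponentiallyStable (ziLoad bshunt Ishunt)
      (Sum.elim (M.ziVoltage bshunt Ishunt)
        (M.inverterVoltages (M.ziVoltage bshunt Ishunt))) := by
  have hpos := M.ziVoltage_pos hM hI
  exact ⟨M.isUnit_det_Bred_add_diagonal hM, hpos, M.reducedPowerFlow_ziVoltage hM Ishunt,
    fun _ hEL h => M.eq_ziVoltage_of_reducedPowerFlow hM hEL h, M.inverterVoltages_pos hpos,
    M.isLocallyExponentiallyStable_zi hM hI⟩
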